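/- Let $K$ be a field, $n,t\ge 1$ integers and $S=K[x_1,\dots,x_n]$. A monomial $x_{i_1}\cdots x_{i_d}$ is called $t$-spread if its indices can be ordered so that $i_j-i_{j-1}\ge t$ for $2\le j\le d$. A $t$-spread monomial ideal is an ideal generated by $t$-spread monomials; such an ideal $I$, with minimal set of monomial generators $G(I)$, is called $t$-spread strongly stable if for all $t$-spread $u\in G(I)$, all $x_j\mid u$ and all $1\le i<j$ such that $x_i(u/x_j)$ is $t$-spread, one has $x_i(u/x_j)\in I$. For a $t$-spread monomial $u$, let $B_t(u)$ denote the smallest $t$-spread strongly stable ideal containing $u$. For an ideal $I\subset S$ let $\operatorname{Ass}(I)$ be the set of associated primes of $S/I$ and $\operatorname{Min}(I)$ the set of minimal primes of $I$. A monomial ideal $I$ is normally torsionfree if $\operatorname{Ass}(I^k)=\operatorname{Min}(I)$ for all $k\ge1$. It is almost normally torsionfree if there are an integer $k\ge 1$ and a monomial prime ideal $P$ such that $\operatorname{Ass}(I^m)=\operatorname{Min}(I)$ for $1\le m\le k$ and $\operatorname{Ass}(I^m)\subseteq\operatorname{Min}(I)\cup\{P\}$ for $m\ge k+1$. Let $\operatorname{Ass}^\infty(I)$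 be the set of monomial prime ideals $P\supseteq I$ that are associated to $I^k$ for some $k\ge1$ and such that, for every $k\ge 1$, $P\in\operatorname{Ass}(I^k)$ implies $P\in\operatorname{Ass}(I^{k+1})$. **Proposition.** Let $u=x_ix_n$ be a $t$-spread monomial in $S$ with $i\ge t$, and let $I=B_t(u)$. Then $I$ is almost normally torsionfree. Moreover, $I$ is normally torsionfree if and only if $i=t$. If $i>t$, then $\operatorname{Ass}^\infty(I)=\operatorname{Min}(I)\cup\{(x_1,\dots,x_n)\}$. -/

import Mathlib

open MvPolynomial

namespace TSpread

variable {K : Type*} [Field K] {n : ℕ}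

/-- `I ⊆ S = K[x_1, …, x_n]` is a monomial ideal: it is generated by monomials. The variable `x_j`
is `X` at the element of `Fin n` with value `j - 1`; a monomial is given by its exponent vector. -/
def IsMonomialIdeal (I : Ideal (MvPolynomial (Fin n) K)) : Prop :=
  ∃ A : Set (Fin n →₀ ℕ), I = Ideal.span ((fun a => monomial a (1 : K)) '' A)

/-- A monomial prime ideal: a prime ideal which is a monomial ideal. -/
def IsMonomialPrime (P : Ideal (MvPolynomial (Fin n) K)) : Prop :=
  P.IsPrime ∧ IsMonomialIdeal P

/-- `G(I)`: the minimal set of monomial generators of a monomial ideal `I`, i.e. the monomials of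
`I` that are minimal with respect to divisibility. -/
def minGens (I : Ideal (MvPolynomial (Fin n) K)) : Set (Fin n →₀ ℕ) :=
  {a | Minimal (fun b => monomial b (1 : K) ∈ I) a}

/-- The monomial with exponent vector `a` is `t`-spread: it is `x_{i_1} x_{i_2} ⋯ x_{i_d}` for a
sequence of indices with `i_{j} - i_{j-1} ≥ t` for `2 ≤ j ≤ d`. -/
def IsTSpread (t : ℕ) (a : Fin n →₀ ℕ) : Prop :=
  ∃ l : List (Fin n), l.IsChain (fun p q : Fin n => (p : ℕ) + t ≤ (q : ℕ)) ∧
    a = (l.map (fun p => Finsupp.single p 1)).sum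

/-- A `t`-spread monomial ideal: an ideal generated by `t`-spread monomials. -/
def IsTSpreadIdeal (t : ℕ) (I : Ideal (MvPolynomial (Fin n) K)) : Prop :=
  ∃ A : Set (Fin n →₀ ℕ), (∀ a ∈ A, IsTSpread t a) ∧
    I = Ideal.span ((fun a => monomial a (1 : K)) '' A)

/-- A `t`-spread strongly stable ideal: a `t`-spread monomial ideal `I` such that for every
`t`-spread `u ∈ G(I)`, every `j ∈ supp(u)` and every `i < j` for which `x_i (u / x_j)` is
`t`-spread, one has `x_i (u / x_j) ∈ I`. -/
def IsTSpreadStronglyStable (t : ℕ) (I : Ideal (MvPolynomial (Fin n) K)) : Prop :=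
  IsTSpreadIdeal t I ∧
    ∀ u ∈ minGens I, IsTSpread t u → ∀ j ∈ u.support, ∀ i : Fin n, i < j →
      IsTSpread t (u - Finsupp.single j 1 + Finsupp.single i 1) →
        monomial (u - Finsupp.single j 1 + Finsupp.single i 1) (1 : K) ∈ I

variable (K) in
/-- `B_t(u)`: the smallest `t`-spread strongly stable ideal of `K[x_1, …, x_n]` containing the
monomial with exponent vector `u`. -/
noncomputable def borel (t : ℕ) (u : Fin n →₀ ℕ) : Ideal (MvPolynomial (Fin n) K) :=
  sInf {J | IsTSpreadStronglyStable t J ∧ monomial u (1 : K) ∈ J}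

/-- `Ass(I)`: the set of associated prime ideals of `S ⧸ I`. -/
def Ass (I : Ideal (MvPolynomial (Fin n) K)) : Set (Ideal (MvPolynomial (Fin n) K)) :=
  associatedPrimes (MvPolynomial (Fin n) K) (MvPolynomial (Fin n) K ⧸ I)

/-- A monomial ideal `I` is normally torsionfree if `Ass(I^k) = Min(I)` for all `k ≥ 1`. -/
def IsNormallyTorsionfree (I : Ideal (MvPolynomial (Fin n) K)) : Prop :=
  ∀ k : ℕ, 1 ≤ k → Ass (I ^ k) = I.minimalPrimes

/-- A monomial ideal `I` is almost normally torsionfree if there are a positive integer `k` and a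
monomial prime ideal `P` with `Ass(I^m) = Min(I)` for `1 ≤ m ≤ k` and
`Ass(I^m) ⊆ Min(I) ∪ {P}` for `m ≥ k + 1`. -/
def IsAlmostNormallyTorsionfree (I : Ideal (MvPolynomial (Fin n) K)) : Prop :=
  ∃ k : ℕ, 1 ≤ k ∧ ∃ P : Ideal (MvPolynomial (Fin n) K), IsMonomialPrime P ∧
    (∀ m : ℕ, 1 ≤ m → m ≤ k → Ass (I ^ m) = I.minimalPrimes) ∧
    (∀ m : ℕ, k + 1 ≤ m → Ass (I ^ m) ⊆ I.minimalPrimes ∪ {P})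

/-- `Ass^∞(I)`: the set of monomial persistent prime ideals of `I`, that is, of the monomial prime
ideals `P ⊇ I` which are associated to some power of `I` and which lie in `Ass(I^(k+1))` whenever
they lie in `Ass(I^k)`, `k ≥ 1`. -/
def AssInfty (I : Ideal (MvPolynomial (Fin n) K)) : Set (Ideal (MvPolynomial (Fin n) K)) :=
  {P | IsMonomialPrime P ∧ I ≤ P ∧ (∃ k : ℕ, 1 ≤ k ∧ P ∈ Ass (I ^ k)) ∧
    ∀ k : ℕ, 1 ≤ k → P ∈ Ass (I ^ k) → P ∈ Ass (I ^ (k + 1))}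

end TSpread

/-! The ideal `B_t(x_i x_n)` is the edge ideal of the graph with edges `a ≤ p`, `a + t ≤ b`
(`borel_eq_edgeIdeal`), so its minimal primes come from minimal vertex covers. Every cover bounds
from below the order of the elements of `I ^ k`; the crux is a partial converse, the weighted König
statement `exists_sumset_le`: these bounds detect membership of a monomial in `I ^ k` if the graph
is bipartite (`p < t`) or if some exponent is at least `k`.

If `I ^ k : f = P` is prime, `f` may be multiplied by the `k`-th powers of all variables outside `P`
without changing the colon ideal. As soon as `P` omits a variable, the second condition is therefore
free, and `exists_cover_of_mem_Ass` identifies `P` with the prime of a minimal cover. Only the ideal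
of all variables can escape. For `k = 1` it does not; for `t ≤ p` the triangle `0, t, 2t` makes it
associated to every power from the second on (`span_range_X_mem_Ass_pow`). -/

namespace TSpread

/-! ### Weighted vertex covers and packings of edges. -/

section Combinatorics

variable {n : ℕ}

/-- The total exponent of the monomial `x^c` in the variables belonging to `C`. -/
def weight (C : Finset (Fin n)) (c : Fin n →₀ ℕ) : ℕ := ∑ v ∈ C, c v

theorem weight_add (C : Finset (Fin n)) (c d : Fin n →₀ ℕ) :
    weight C (c + d) = weight C c + weight C d := by
  simp [weight, Finset.sum_add_distrib]

theorem weight_single (C : Finset (Fin n)) (v : Fin n) (m : ℕ) :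
    weight C (Finsupp.single v m) = if v ∈ C then m else 0 := by
  simp [weight, Finsupp.single_apply]

theorem weight_mono_left {C D : Finset (Fin n)} (h : C ⊆ D) (c : Fin n →₀ ℕ) :
    weight C c ≤ weight D c :=
  Finset.sum_le_sum_of_subset h

theorem weight_mono_right (C : Finset (Fin n)) {c d : Fin n →₀ ℕ} (h : c ≤ d) :
    weight C c ≤ weight C d :=
  Finset.sum_le_sum fun v _ => h v

theorem le_weight {C : Finset (Fin n)} {v : Fin n} (hv : v ∈ C) (c : Fin n →₀ ℕ) :
    c v ≤ weight C c :=
  Finset.single_le_sum (f := fun v => c v) (fun _ _ => Nat.zero_le _) hv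

theorem add_le_weight {C : Finset (Fin n)} {v w : Fin n} (hvw : v ≠ w) (hv : v ∈ C) (hw : w ∈ C)
    (c : Fin n →₀ ℕ) : c v + c w ≤ weight C c := by
  rw [← Finset.sum_pair (f := fun v => c v) hvw]
  exact Finset.sum_le_sum_of_subset (by
    intro x hx
    rcases Finset.mem_insert.1 hx with rfl | hx
    · exact hv
    · rw [Finset.mem_singleton.1 hx]; exact hw)

/-- A vertex cover of the graph whose edges are the pairs `a, b` with `E a b`. -/
def IsCover (E : Fin n → Fin n → Prop) (C : Finset (Fin n)) : Prop :=
  ∀ a b, E a b → a ∈ C ∨ b ∈ C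

/-- The exponent vectors `e_a + e_b` of the edges. -/
def edgeExps (E : Fin n → Fin n → Prop) : Set (Fin n →₀ ℕ) :=
  {e | ∃ a b, E a b ∧ e = Finsupp.single a 1 + Finsupp.single b 1}

/-- The `k`-fold sumset of a set of exponent vectors. -/
def sumset (A : Set (Fin n →₀ ℕ)) : ℕ → Set (Fin n →₀ ℕ)
  | 0 => {0}
  | k + 1 => {m | ∃ d ∈ sumset A k, ∃ e ∈ A, m = d + e}

/-- Vertices of weight zero are free, so a cover can be tested for superfluous vertices on the
support of `c` alone. -/
theorem weight_erase_union_zeros {C : Finset (Fin n)} {v : Fin n} (hv : v ∈ C) (c : Fin n →₀ ℕ) :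
    weight (C.erase v ∪ Finset.univ.filter fun w => c w = 0) c + c v = weight C c := by
  have h : weight (C.erase v) c = weight (C.erase v ∪ Finset.univ.filter fun w => c w = 0) c :=
    Finset.sum_subset Finset.subset_union_left fun x hx hx' => by
      rcases Finset.mem_union.1 hx with h | h
      · exact absurd h hx'
      · simpa using h
  rw [← h]
  exact Finset.sum_erase_add C (fun v => c v) hv

/-- Removing an edge that lies in no tight cover lowers the covering number by at most one. -/
theorem le_weight_of_add_edge {E : Fin n → Fin n → Prop} {k : ℕ} {c : Fin n →₀ ℕ} {a b : Fin n}
    (hc : ∀ C, IsCover E C →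
      k + 1 ≤ weight C (c + (Finsupp.single a 1 + Finsupp.single b 1)))
    (hboth : ∀ C, IsCover E C → a ∈ C → b ∈ C →
      k + 2 ≤ weight C (c + (Finsupp.single a 1 + Finsupp.single b 1)))
    (C : Finset (Fin n)) (hC : IsCover E C) : k ≤ weight C c := by
  have h1 := hc C hC
  have h2 := hboth C hC
  simp only [weight_add, weight_single] at h1 h2
  -- A cover meeting the edge once loses one unit; one containing both ends loses two, which `hboth`
  -- compensates.
  by_cases ha : a ∈ C <;> by_cases hb : b ∈ C <;> simp [ha, hb] at h1 h2 <;> omega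

theorem exists_add_edge {c : Fin n →₀ ℕ} {a b : Fin n} (hab : a ≠ b) (ha : c a ≠ 0)
    (hb : c b ≠ 0) : ∃ d, c = d + (Finsupp.single a 1 + Finsupp.single b 1) := by
  refine ⟨c - (Finsupp.single a 1 + Finsupp.single b 1), (tsub_add_cancel_of_le ?_).symm⟩
  intro v
  simp only [Finsupp.add_apply, Finsupp.single_apply]
  split_ifs with h1 h2 h2
  · exact absurd (h1.trans h2.symm) hab
  · subst h1; omega
  · subst h2; omega
  · omega

/-- The edges of the graph attached to `B_t(x_i x_n)`. -/
def borelEdge (t : ℕ) (p a b : Fin n) : Prop := a ≤ p ∧ (a : ℕ) + t ≤ b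

/-- If all edges in the support of `c` join a vertex below `s` to a vertex that is at least `s`,
then some edge in the support of `c` lies in no tight cover. -/
theorem exists_edge_not_tight {t : ℕ} {p : Fin n} {k : ℕ} {c : Fin n →₀ ℕ} (s : ℕ)
    (hs : ∀ a b, borelEdge t p a b → c a ≠ 0 → c b ≠ 0 → (a : ℕ) < s ∧ s ≤ b)
    (hc : ∀ C, IsCover (borelEdge t p) C → k + 1 ≤ weight C c) :
    ∃ a b, borelEdge t p a b ∧ a ≠ b ∧ c a ≠ 0 ∧ c b ≠ 0 ∧
      ∀ C, IsCover (borelEdge t p) C → a ∈ C → b ∈ C → k + 2 ≤ weight C c := by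
  classical
  let T : Finset (Fin n) :=
    Finset.univ.filter fun a => c a ≠ 0 ∧ ∃ b, borelEdge t p a b ∧ c b ≠ 0
  have hT : T.Nonempty := by
    by_contra hT
    have hcov : IsCover (borelEdge t p) (Finset.univ.filter fun w => c w = 0) := by
      intro a b hab
      by_contra hn
      simp only [Finset.mem_filter, Finset.mem_univ, true_and, not_or] at hn
      exact hT ⟨a, by simp only [T, Finset.mem_filter, Finset.mem_univ, true_and]
                      exact ⟨hn.1, b, hab, hn.2⟩⟩
    have h0 : weight (Finset.univ.filter fun w => c w = 0) c = 0 :=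
      Finset.sum_eq_zero fun x hx => by simpa using hx
    have := hc _ hcov
    omega
  -- Neighbourhoods among larger vertices are nested and shrink as the left end grows; the largest
  -- left end `a` has the smallest one.
  obtain ⟨a, haT, hmax⟩ := T.exists_max_image id hT
  have ha' := haT
  simp only [T, Finset.mem_filter, Finset.mem_univ, true_and] at ha'
  obtain ⟨ha, b, hab, hb⟩ := ha'
  have hasb := hs a b hab ha hb
  refine ⟨a, b, hab, fun h => by subst h; omega, ha, hb, fun C hC haC hbC => ?_⟩
  by_contra hlt
  -- A cover of weight at most `k + 1` has no superfluous vertex of positive weight.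
  have key : ∀ v ∈ C, c v ≠ 0 →
      ¬ IsCover (borelEdge t p) (C.erase v ∪ Finset.univ.filter fun w => c w = 0) := by
    intro v hv hcv hcov
    have h1 := hc _ hcov
    have h2 := weight_erase_union_zeros hv c
    omega
  -- If `C` contains all supported neighbours of `a`, then `a` is superfluous; otherwise a missing
  -- neighbour `b'` makes `b` superfluous.
  by_cases hN : ∀ b', borelEdge t p a b' → c b' ≠ 0 → b' ∈ C
  · refine key a haC ha fun x y hxy => ?_
    simp only [Finset.mem_union, Finset.mem_erase, Finset.mem_filter, Finset.mem_univ, true_and]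
    by_cases hx : c x = 0
    · exact Or.inl (Or.inr hx)
    by_cases hy : c y = 0
    · exact Or.inr (Or.inr hy)
    have hxy' := hs x y hxy hx hy
    have hya : y ≠ a := fun h => by subst h; omega
    by_cases hxa : x = a
    · subst hxa
      exact Or.inr (Or.inl ⟨hya, hN y hxy hy⟩)
    · rcases hC x y hxy with h | h
      · exact Or.inl (Or.inl ⟨hxa, h⟩)
      · exact Or.inr (Or.inl ⟨hya, h⟩)
  · push Not at hN
    obtain ⟨b', hab', hb', hb'C⟩ := hN
    refine key b hbC hb fun x y hxy => ?_
    simp only [Finset.mem_union, Finset.mem_erase, Finset.mem_filter, Finset.mem_univ, true_and]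
    by_cases hx : c x = 0
    · exact Or.inl (Or.inr hx)
    by_cases hy : c y = 0
    · exact Or.inr (Or.inr hy)
    have hxy' := hs x y hxy hx hy
    have hxb : x ≠ b := fun h => by subst h; omega
    have hxa : x ≤ a := hmax x (by
      simp only [T, Finset.mem_filter, Finset.mem_univ, true_and]
      exact ⟨hx, y, hxy, hy⟩)
    by_cases hyb : y = b
    -- Nestedness: `x ≤ a` makes `b'` a neighbour of `x` too, and `b' ∉ C` forces `x ∈ C`.
    · have hxb' : borelEdge t p x b' := ⟨hxy.1, by
        have h1 : (x : ℕ) ≤ a := hxa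
        have h2 := hab'.2
        omega⟩
      exact Or.inl (Or.inl ⟨hxb, (hC x b' hxb').resolve_right hb'C⟩)
    · rcases hC x y hxy with h | h
      · exact Or.inl (Or.inl ⟨hxb, h⟩)
      · exact Or.inr (Or.inl ⟨hyb, h⟩)

/-- A weighted König theorem: if every vertex cover has weight at least `k`, then `c` dominates a
sum of `k` edges, provided the graph is bipartite or some vertex has weight at least `k`. -/
theorem exists_sumset_le {t : ℕ} (ht : 1 ≤ t) {p : Fin n} (k : ℕ) (c : Fin n →₀ ℕ)
    (hj : (p : ℕ) < t ∨ ∃ j, k ≤ c j)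
    (hc : ∀ C, IsCover (borelEdge t p) C → k ≤ weight C c) :
    ∃ m ∈ sumset (edgeExps (borelEdge t p)) k, m ≤ c := by
  induction k generalizing c with
  | zero => exact ⟨0, rfl, by simp⟩
  | succ k ih =>
    have main : ∃ a b, borelEdge t p a b ∧ a ≠ b ∧ c a ≠ 0 ∧ c b ≠ 0 ∧
        ∀ C, IsCover (borelEdge t p) C → a ∈ C → b ∈ C → k + 2 ≤ weight C c := by
      rcases hj with hpt | ⟨j, hj⟩
      · refine exists_edge_not_tight t (fun a b hab _ _ => ?_) hc
        have h1 : (a : ℕ) ≤ p := hab.1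
        have h2 := hab.2
        omega
      -- A supported edge at `j` already weighs `(k + 1) + 1`, so no tight cover contains both its
      -- ends.
      · by_cases hN : ∃ v, c v ≠ 0 ∧ (borelEdge t p j v ∨ borelEdge t p v j)
        · obtain ⟨v, hv, h | h⟩ := hN
          · have hne : j ≠ v := fun e => by subst e; have := h.2; omega
            refine ⟨j, v, h, hne, by omega, hv, fun C _ h1 h2 => ?_⟩
            have := add_le_weight hne h1 h2 c
            omega
          · have hne : v ≠ j := fun e => by subst e; have := h.2; omega
            refine ⟨v, j, h, hne, hv, by omega, fun C _ h1 h2 => ?_⟩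
            have := add_le_weight hne h1 h2 c
            omega
        · push Not at hN
          -- If no supported vertex is adjacent to `j`, every supported edge `a, b` straddles it: `j
          -- < a + t ≤ b`, and `j ≤ a` would make `j, b` an edge.
          refine exists_edge_not_tight j (fun a b hab ha hb => ?_) hc
          have h1 := (hN a ha).2
          have h2 := (hN b hb).1
          simp only [borelEdge, Fin.le_def] at h1 h2 hab
          omega
    obtain ⟨a, b, hab, hne, ha, hb, hboth⟩ := main
    obtain ⟨d, rfl⟩ := exists_add_edge hne ha hb
    obtain ⟨m, hm, hmd⟩ := ih d (hj.imp_right fun ⟨j, hj⟩ => ⟨j, by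
      simp only [Finsupp.add_apply, Finsupp.single_apply] at hj
      split_ifs at hj with h1 h2
      · exact absurd (h1.trans h2.symm) hne
      all_goals omega⟩) (le_weight_of_add_edge hc hboth)
    exact ⟨_, ⟨m, hm, _, ⟨a, b, hab, rfl⟩, rfl⟩, by gcongr⟩

/-- For `k = 1` the covering criterion holds for every graph. -/
theorem exists_cover_weight_lt_one {E : Fin n → Fin n → Prop} (hE : ∀ a b, E a b → a ≠ b)
    (c : Fin n →₀ ℕ) (hc : ¬ ∃ m ∈ sumset (edgeExps E) 1, m ≤ c) :
    ∃ C, IsCover E C ∧ weight C c < 1 := by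
  refine ⟨Finset.univ.filter fun w => c w = 0, fun a b hab => ?_, ?_⟩
  · by_contra hn
    simp only [Finset.mem_filter, Finset.mem_univ, true_and, not_or] at hn
    obtain ⟨d, rfl⟩ := exists_add_edge (hE a b hab) hn.1 hn.2
    exact hc ⟨0 + _, ⟨0, rfl, _, ⟨a, b, hab, rfl⟩, rfl⟩, by simp⟩
  · rw [Nat.lt_one_iff]
    exact Finset.sum_eq_zero fun x hx => by simpa using hx

/-- Used with `r = 1` for the order along a cover and with `r = 2` for the total degree. -/
theorem weight_le_of_mem_sumset {A : Set (Fin n →₀ ℕ)} {C : Finset (Fin n)} {r : ℕ}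
    (hA : ∀ e ∈ A, r ≤ weight C e) {k : ℕ} {m : Fin n →₀ ℕ} (hm : m ∈ sumset A k) :
    k * r ≤ weight C m := by
  induction k generalizing m with
  | zero => simp
  | succ k ih =>
    obtain ⟨d, hd, e, he, rfl⟩ := hm
    rw [weight_add, add_mul, one_mul]
    exact add_le_add (ih hd) (hA e he)

end Combinatorics

/-! ### Edge ideals, order along a cover, and associated primes of powers. -/

section Algebra

variable {K : Type*} [Field K] {n : ℕ}

variable (K) in
/-- The edge ideal of the graph with edges `a, b` for `E a b`. -/
noncomputable def edgeIdeal (E : Fin n → Fin n → Prop) : Ideal (MvPolynomial (Fin n) K) :=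
  Ideal.span ((fun a => monomial a (1 : K)) '' edgeExps E)

theorem span_monomial_pow (A : Set (Fin n →₀ ℕ)) (k : ℕ) :
    Ideal.span ((fun a => monomial a (1 : K)) '' A) ^ k =
      Ideal.span ((fun a => monomial a (1 : K)) '' sumset A k) := by
  induction k with
  | zero => simp [sumset]
  | succ k ih =>
    rw [pow_succ, ih, Ideal.span_mul_span']
    congr 1
    ext x
    simp only [Set.mem_mul, Set.mem_image, sumset, Set.mem_ofPred_eq]
    constructor
    · rintro ⟨_, ⟨d, hd, rfl⟩, _, ⟨e, he, rfl⟩, rfl⟩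
      exact ⟨d + e, ⟨d, hd, e, he, rfl⟩, by simp [monomial_mul]⟩
    · rintro ⟨_, ⟨d, hd, e, he, rfl⟩, rfl⟩
      exact ⟨_, ⟨d, hd, rfl⟩, _, ⟨e, he, rfl⟩, by simp [monomial_mul]⟩

theorem mem_edgeIdeal_pow {E : Fin n → Fin n → Prop} {k : ℕ} {f : MvPolynomial (Fin n) K} :
    f ∈ edgeIdeal K E ^ k ↔ ∀ c ∈ f.support, ∃ m ∈ sumset (edgeExps E) k, m ≤ c := by
  rw [edgeIdeal, span_monomial_pow, mem_ideal_span_monomial_image]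

theorem monomial_mem_span_iff {A : Set (Fin n →₀ ℕ)} {c : Fin n →₀ ℕ} :
    monomial c (1 : K) ∈ Ideal.span ((fun a => monomial a (1 : K)) '' A) ↔ ∃ m ∈ A, m ≤ c := by
  rw [mem_ideal_span_monomial_image]
  simp

variable (K) in
/-- The homomorphism `x_v ↦ x_v T` for `v ∈ C` and `x_v ↦ x_v` otherwise, which records the order
of a polynomial along the prime ideal generated by the variables in `C`. -/
noncomputable def grading (C : Finset (Fin n)) :
    MvPolynomial (Fin n) K →ₐ[K] Polynomial (MvPolynomial (Fin n) K) :=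
  aeval fun v => Polynomial.C (X v) * Polynomial.X ^ (if v ∈ C then 1 else 0)

theorem grading_monomial (C : Finset (Fin n)) (c : Fin n →₀ ℕ) (r : K) :
    grading K C (monomial c r) = Polynomial.C (monomial c r) * Polynomial.X ^ weight C c := by
  have hw : weight C c = ∑ v, (if v ∈ C then 1 else 0) * c v := by
    simp [weight]
  rw [grading, aeval_monomial, Finsupp.prod_fintype _ _ (by simp), monomial_eq,
    Finsupp.prod_fintype _ _ (by simp), map_mul, map_prod, hw, ← Finset.prod_pow_eq_pow_sum,
    mul_assoc, ← Finset.prod_mul_distrib]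
  congr 1
  refine Finset.prod_congr rfl fun v _ => ?_
  rw [mul_pow, ← pow_mul, map_pow]

/-- Distinct monomials cannot cancel, so the order of a polynomial along `C` is the least weight in
its support. -/
theorem coeff_coeff_grading (C : Finset (Fin n)) (f : MvPolynomial (Fin n) K) (d : ℕ)
    (c : Fin n →₀ ℕ) :
    coeff c ((grading K C f).coeff d) = if weight C c = d then coeff c f else 0 := by
  induction f using MvPolynomial.induction_on' with
  | monomial u r =>
    rw [grading_monomial, Polynomial.coeff_C_mul_X_pow]
    by_cases h : u = c
    · subst h
      by_cases h' : weight C u = d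
      · subst h'; simp
      · simp [h', Ne.symm h']
    · by_cases h' : d = weight C u <;> simp [h', coeff_monomial, h]
  | add f g hf hg =>
    rw [map_add, Polynomial.coeff_add, coeff_add, hf, hg, coeff_add]
    split_ifs <;> simp

theorem X_pow_dvd_grading {C : Finset (Fin n)} {f : MvPolynomial (Fin n) K} {k : ℕ} :
    Polynomial.X ^ k ∣ grading K C f ↔ ∀ c ∈ f.support, k ≤ weight C c := by
  rw [Polynomial.X_pow_dvd_iff]
  constructor
  · intro h c hc
    by_contra hlt
    have := congrArg (coeff c) (h _ (not_le.1 hlt))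
    rw [coeff_coeff_grading, if_pos rfl, coeff_zero] at this
    exact (mem_support_iff.1 hc) this
  · intro h d hd
    ext c
    rw [coeff_coeff_grading, coeff_zero]
    split_ifs with hw
    · by_contra hne
      have := h c (mem_support_iff.2 hne)
      omega
    · rfl

theorem mem_span_X_image_iff {C : Finset (Fin n)} {f : MvPolynomial (Fin n) K} :
    f ∈ Ideal.span ((X : Fin n → MvPolynomial (Fin n) K) '' C) ↔
      Polynomial.X ∣ grading K C f := by
  rw [← pow_one (Polynomial.X : Polynomial (MvPolynomial (Fin n) K)), X_pow_dvd_grading,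
    mem_ideal_span_X_image]
  refine forall₂_congr fun c _ => ?_
  rw [Nat.one_le_iff_ne_zero, weight, Ne, Finset.sum_eq_zero_iff]
  push Not
  rfl

theorem isPrime_span_X_image (C : Finset (Fin n)) :
    (Ideal.span ((X : Fin n → MvPolynomial (Fin n) K) '' C)).IsPrime := by
  have : Ideal.span ((X : Fin n → MvPolynomial (Fin n) K) '' C) =
      (Ideal.span {(Polynomial.X : Polynomial (MvPolynomial (Fin n) K))}).comap (grading K C) := by
    ext f
    rw [mem_span_X_image_iff, Ideal.mem_comap, Ideal.mem_span_singleton]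
  rw [this]
  have := (Ideal.span_singleton_prime Polynomial.X_ne_zero).2
    (Polynomial.prime_X (R := MvPolynomial (Fin n) K))
  exact Ideal.comap_isPrime _ _

theorem isMonomialIdeal_span_X_image (C : Set (Fin n)) :
    IsMonomialIdeal (Ideal.span ((X : Fin n → MvPolynomial (Fin n) K) '' C)) := by
  refine ⟨(fun v => Finsupp.single v 1) '' C, ?_⟩
  rw [Set.image_image]
  rfl

theorem X_mem_span_X_image {C : Finset (Fin n)} {v : Fin n} :
    (X v : MvPolynomial (Fin n) K) ∈ Ideal.span ((X : Fin n → MvPolynomial (Fin n) K) '' C) ↔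
      v ∈ C := by
  classical
  rw [mem_ideal_span_X_image]
  simp [support_X, Finsupp.single_apply]

theorem monomial_edge (a b : Fin n) :
    monomial (Finsupp.single a 1 + Finsupp.single b 1) (1 : K) = X a * X b := by
  rw [X, X, monomial_mul, one_mul]

theorem edgeIdeal_le_iff {E : Fin n → Fin n → Prop} {J : Ideal (MvPolynomial (Fin n) K)} :
    edgeIdeal K E ≤ J ↔ ∀ a b, E a b → X a * X b ∈ J := by
  rw [edgeIdeal, Ideal.span_le, Set.image_subset_iff]
  constructor
  · intro h a b hab
    have := h ⟨a, b, hab, rfl⟩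
    rwa [Set.mem_preimage, monomial_edge] at this
  · rintro h _ ⟨a, b, hab, rfl⟩
    rw [Set.mem_preimage, monomial_edge]
    exact h a b hab

theorem edgeIdeal_le_span_X_image {E : Fin n → Fin n → Prop} {C : Finset (Fin n)}
    (hC : IsCover E C) :
    edgeIdeal K E ≤ Ideal.span ((X : Fin n → MvPolynomial (Fin n) K) '' C) := by
  rw [edgeIdeal_le_iff]
  intro a b hab
  rcases hC a b hab with h | h
  · exact Ideal.mul_mem_right _ _ (X_mem_span_X_image.2 h)
  · exact Ideal.mul_mem_left _ _ (X_mem_span_X_image.2 h)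

/-- The primes generated by minimal vertex covers are minimal primes of the edge ideal. -/
theorem span_X_image_mem_minimalPrimes {E : Fin n → Fin n → Prop} {C : Finset (Fin n)}
    (hC : Minimal (IsCover E) C) :
    Ideal.span ((X : Fin n → MvPolynomial (Fin n) K) '' C) ∈ (edgeIdeal K E).minimalPrimes := by
  classical
  refine ⟨⟨isPrime_span_X_image C, edgeIdeal_le_span_X_image hC.1⟩, fun Q hQ hQC => ?_⟩
  have hcov : IsCover E (Finset.univ.filter fun v => (X v : MvPolynomial (Fin n) K) ∈ Q) := by
    intro a b hab
    simpa using hQ.1.mem_or_mem (edgeIdeal_le_iff.1 hQ.2 a b hab)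
  have hle := hC.2 hcov (by
    intro v hv
    exact X_mem_span_X_image.1 (hQC (Finset.mem_filter.1 hv).2))
  rw [Ideal.span_le]
  rintro _ ⟨v, hv, rfl⟩
  exact (Finset.mem_filter.1 (hle hv)).2

theorem mem_Ass_iff {J P : Ideal (MvPolynomial (Fin n) K)} :
    P ∈ Ass J ↔ P.IsPrime ∧ ∃ f, ∀ g, g ∈ P ↔ g * f ∈ J := by
  rw [Ass, AssociatedPrimes.mem_iff, isAssociatedPrime_iff]
  refine and_congr_right fun _ => ?_
  constructor
  · rintro ⟨x, hx⟩
    obtain ⟨f, rfl⟩ := Ideal.Quotient.mk_surjective x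
    refine ⟨f, fun g => ?_⟩
    rw [hx, Submodule.mem_colon_singleton, Submodule.mem_bot, ← Ideal.Quotient.eq_zero_iff_mem,
      map_mul]
    rfl
  · rintro ⟨f, hf⟩
    refine ⟨Ideal.Quotient.mk J f, ?_⟩
    ext g
    rw [hf, Submodule.mem_colon_singleton, Submodule.mem_bot, ← Ideal.Quotient.eq_zero_iff_mem,
      map_mul]
    rfl

theorem monomial_mem_isPrime {P : Ideal (MvPolynomial (Fin n) K)} (hP : P.IsPrime)
    {c : Fin n →₀ ℕ} (hc : monomial c (1 : K) ∈ P) : ∃ v, c v ≠ 0 ∧ X v ∈ P := by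
  rw [monomial_eq, C_1, one_mul, Finsupp.prod] at hc
  obtain ⟨v, hv, hvP⟩ := (Ideal.IsPrime.prod_mem_iff (hp := hP)).1 hc
  exact ⟨v, Finsupp.mem_support_iff.1 hv, hP.mem_of_pow_mem _ hvP⟩

/-- If the powers of an edge ideal are detected by vertex covers on the monomials that are highly
divisible by the variables outside `P`, then an associated prime `P` of such a power is generated
by a minimal vertex cover. -/
theorem exists_cover_of_mem_Ass {E : Fin n → Fin n → Prop} {k : ℕ}
    {P : Ideal (MvPolynomial (Fin n) K)} (hP : P ∈ Ass (edgeIdeal K E ^ k))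
    (hE : ∀ c : Fin n →₀ ℕ, (∀ j, (X j : MvPolynomial (Fin n) K) ∉ P → k ≤ c j) →
      (¬ ∃ m ∈ sumset (edgeExps E) k, m ≤ c) → ∃ C, IsCover E C ∧ weight C c < k) :
    ∃ C : Finset (Fin n), Minimal (IsCover E) C ∧
      P = Ideal.span ((X : Fin n → MvPolynomial (Fin n) K) '' C) := by
  classical
  obtain ⟨hPp, f, hf⟩ := mem_Ass_iff.1 hP
  -- `W` involves only variables outside the prime `P`, so `monomial W 1 ∉ P`, and multiplying `f`
  -- by it stays outside `I ^ k`.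
  set W : Fin n →₀ ℕ := Finsupp.equivFunOnFinite.symm
    fun j => if (X j : MvPolynomial (Fin n) K) ∈ P then 0 else k with hW
  have hWj : ∀ j, W j = if (X j : MvPolynomial (Fin n) K) ∈ P then 0 else k := fun j => rfl
  have hWP : monomial W (1 : K) ∉ P := fun h => by
    obtain ⟨v, hv, hvP⟩ := monomial_mem_isPrime hPp h
    rw [hWj, if_pos hvP] at hv
    exact hv rfl
  have hnot : monomial W (1 : K) * f ∉ edgeIdeal K E ^ k := fun h => hWP ((hf _).2 h)
  rw [mem_edgeIdeal_pow] at hnot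
  push Not at hnot
  obtain ⟨c, hcs, hcm⟩ := hnot
  have hcj : ∀ j, (X j : MvPolynomial (Fin n) K) ∉ P → k ≤ c j := by
    intro j hj
    have hWc : W ≤ c := by
      by_contra hn
      rw [mem_support_iff, coeff_monomial_mul', if_neg hn] at hcs
      exact hcs rfl
    have := hWc j
    rwa [hWj, if_neg hj] at this
  obtain ⟨C', hC', hlt'⟩ := hE c hcj (by push Not; exact hcm)
  obtain ⟨C, hCC', hC⟩ := exists_minimal_le_of_wellFoundedLT (IsCover E) C' hC'
  have hlt : weight C c < k := (weight_mono_left hCC' c).trans_lt hlt'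
  refine ⟨C, hC, le_antisymm (fun g hg => ?_) ?_⟩
  · rw [mem_span_X_image_iff]
    by_contra hng
    have h1 : Polynomial.X ^ k ∣ grading K C (g * (monomial W (1 : K) * f)) := by
      rw [X_pow_dvd_grading]
      intro d hd
      have hmem : g * (monomial W (1 : K) * f) ∈ edgeIdeal K E ^ k := by
        rw [mul_left_comm]
        exact Ideal.mul_mem_left _ _ ((hf g).1 hg)
      obtain ⟨m, hm, hmd⟩ := mem_edgeIdeal_pow.1 hmem d hd
      refine le_trans ?_ (weight_mono_right C hmd)
      have hA : ∀ e ∈ edgeExps E, 1 ≤ weight C e := by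
        rintro _ ⟨a, b, hab, rfl⟩
        rw [weight_add, weight_single, weight_single]
        rcases hC.1 a b hab with h | h <;> simp [h]
      simpa using weight_le_of_mem_sumset hA hm
    rw [map_mul] at h1
    -- If `g` has order zero along `C`, primality of `Polynomial.X` passes all `k` factors to the
    -- other factor, whose term `c` has weight below `k`.
    have h2 := Polynomial.prime_X.pow_dvd_of_dvd_mul_left k hng h1
    have := X_pow_dvd_grading.1 h2 c hcs
    omega
  · rw [Ideal.span_le]
    rintro _ ⟨v, hv, rfl⟩
    by_contra hvP
    have h1 := hcj v hvP
    have h2 := le_weight hv c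
    omega

/-- `I` and `I ^ k` have the same radical, hence the same minimal primes, and minimal primes of an
ideal are associated in a Noetherian ring. -/
theorem minimalPrimes_subset_Ass_pow (I : Ideal (MvPolynomial (Fin n) K)) {k : ℕ} (hk : 1 ≤ k) :
    I.minimalPrimes ⊆ Ass (I ^ k) := by
  have h := Module.associatedPrimes.minimalPrimes_annihilator_subset_associatedPrimes
    (MvPolynomial (Fin n) K) (MvPolynomial (Fin n) K ⧸ I ^ k)
  rwa [Ideal.annihilator_quotient, ← Ideal.radical_minimalPrimes, Ideal.radical_pow _ (by omega),
    Ideal.radical_minimalPrimes] at h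

end Algebra

end TSpread

namespace TSpread

/-! ### Identification of `B_t(x_i x_n)` with an edge ideal. -/

section Borel

variable {K : Type*} [Field K] {n : ℕ}

theorem sum_map_single_apply_ne_zero (l : List (Fin n)) (v : Fin n) :
    ((l.map fun p => Finsupp.single p 1).sum : Fin n →₀ ℕ) v ≠ 0 ↔ v ∈ l := by
  induction l with
  | nil => simp
  | cons x l ih =>
    rw [List.map_cons, List.sum_cons, Finsupp.add_apply, List.mem_cons, ← ih,
      Finsupp.single_apply]
    by_cases h : x = v
    · simp [h]
    · simp [h, Ne.symm h]

/-- The pointwise form makes it visible that divisors of `t`-spread monomials are `t`-spread. -/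
theorem isTSpread_iff {t : ℕ} (ht : 1 ≤ t) (a : Fin n →₀ ℕ) :
    IsTSpread t a ↔ (∀ v, a v ≤ 1) ∧
      ∀ v w : Fin n, v < w → a v ≠ 0 → a w ≠ 0 → (v : ℕ) + t ≤ w := by
  constructor
  · rintro ⟨l, hl, rfl⟩
    have htr : IsTrans (Fin n) fun p q : Fin n => (p : ℕ) + t ≤ q := ⟨fun _ _ _ _ _ => by omega⟩
    rw [List.isChain_iff_pairwise] at hl
    induction l with
    | nil => simp
    | cons x l ih =>
      rw [List.pairwise_cons] at hl
      obtain ⟨ih1, ih2⟩ := ih hl.2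
      have hx : x ∉ l := fun h => by have := hl.1 x h; omega
      have hx0 : ((l.map fun p => Finsupp.single p 1).sum : Fin n →₀ ℕ) x = 0 := by
        by_contra h
        exact hx ((sum_map_single_apply_ne_zero l x).1 h)
      refine ⟨fun v => ?_, fun v w hvw hv hw => ?_⟩
      · rw [List.map_cons, List.sum_cons, Finsupp.add_apply, Finsupp.single_apply]
        split_ifs with h
        · rw [← h, hx0]
        · rw [zero_add]; exact ih1 v
      · rw [sum_map_single_apply_ne_zero, List.mem_cons] at hv hw
        rcases hv with rfl | hv
        · rcases hw with rfl | hw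
          · exact absurd hvw (lt_irrefl _)
          · exact hl.1 w hw
        · rcases hw with rfl | hw
          · have := hl.1 v hv
            have : (v : ℕ) < w := hvw
            omega
          · exact ih2 v w hvw ((sum_map_single_apply_ne_zero l v).2 hv)
              ((sum_map_single_apply_ne_zero l w).2 hw)
  · rintro ⟨h1, h2⟩
    refine ⟨a.support.sort (· ≤ ·), List.Pairwise.isChain ?_, ?_⟩
    · refine (a.support.sortedLT_sort.pairwise).imp_of_mem fun {x y} hx hy hxy => ?_
      rw [Finset.mem_sort, Finsupp.mem_support_iff] at hx hy
      exact h2 x y hxy hx hy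
    · rw [← Multiset.sum_coe, ← Multiset.map_coe, Finset.sort_eq]
      conv_lhs => rw [← Finsupp.sum_single a]
      refine Finset.sum_congr rfl fun v hv => ?_
      have := h1 v
      have := Finsupp.mem_support_iff.1 hv
      rw [show a v = 1 by omega]

theorem IsTSpread.mono {t : ℕ} (ht : 1 ≤ t) {a b : Fin n →₀ ℕ} (hb : IsTSpread t b) (hab : a ≤ b) :
    IsTSpread t a := by
  rw [isTSpread_iff ht] at hb ⊢
  refine ⟨fun v => (hab v).trans (hb.1 v), fun v w hvw hv hw => hb.2 v w hvw ?_ ?_⟩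
  · have := hab v
    omega
  · have := hab w
    omega

theorem isTSpread_pair_of_le {t : ℕ} {a b : Fin n} (h : (a : ℕ) + t ≤ b) :
    IsTSpread t (Finsupp.single a 1 + Finsupp.single b 1) :=
  ⟨[a, b], by simpa using h, by simp⟩

theorem IsTSpread.pair_le {t : ℕ} (ht : 1 ≤ t) {a b : Fin n}
    (h : IsTSpread t (Finsupp.single a 1 + Finsupp.single b 1)) :
    (a : ℕ) + t ≤ b ∨ (b : ℕ) + t ≤ a := by
  rw [isTSpread_iff ht] at h
  rcases lt_trichotomy a b with hab | rfl | hab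
  · exact Or.inl (h.2 a b hab (by simp) (by simp))
  · have := h.1 a
    simp at this
  · exact Or.inr (h.2 b a hab (by simp) (by simp))

theorem monomial_mem_of_le {J : Ideal (MvPolynomial (Fin n) K)} {v w : Fin n →₀ ℕ}
    (hv : monomial v (1 : K) ∈ J) (hvw : v ≤ w) : monomial w (1 : K) ∈ J := by
  have : monomial w (1 : K) = monomial (w - v) 1 * monomial v 1 := by
    rw [monomial_mul, tsub_add_cancel_of_le hvw, one_mul]
  rw [this]
  exact Ideal.mul_mem_left _ _ hv

/-- In a `t`-spread strongly stable ideal the exchange property holds for all `t`-spread monomials,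
not only for the minimal generators. -/
theorem IsTSpreadStronglyStable.exchange {t : ℕ} (ht : 1 ≤ t)
    {J : Ideal (MvPolynomial (Fin n) K)} (hJ : IsTSpreadStronglyStable t J) {w : Fin n →₀ ℕ}
    (hw : IsTSpread t w) (hwJ : monomial w (1 : K) ∈ J) {i j : Fin n} (hij : i < j)
    (hnew : IsTSpread t (w - Finsupp.single j 1 + Finsupp.single i 1)) :
    monomial (w - Finsupp.single j 1 + Finsupp.single i 1) (1 : K) ∈ J := by
  obtain ⟨v, hvw, hv⟩ :=
    exists_minimal_le_of_wellFoundedLT (fun b => monomial b (1 : K) ∈ J) w hwJ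
  have hle : v - Finsupp.single j 1 + Finsupp.single i 1 ≤
      w - Finsupp.single j 1 + Finsupp.single i 1 :=
    add_le_add (tsub_le_tsub_right hvw _) le_rfl
  -- If the minimal generator `v` dividing `w` avoids `x_j`, it already divides the new monomial.
  by_cases hvj : v j = 0
  · refine monomial_mem_of_le hv.1 fun x => ?_
    have := hvw x
    simp only [Finsupp.add_apply, Finsupp.tsub_apply, Finsupp.single_apply]
    by_cases hx : j = x
    · subst hx; omega
    · simp only [hx, if_false]; omega
  · exact monomial_mem_of_le (hJ.2 v hv (hw.mono ht hvw) j (Finsupp.mem_support_iff.2 hvj) i hij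
      (hnew.mono ht hle)) hle

theorem isTSpreadStronglyStable_edgeIdeal {t : ℕ} (ht : 1 ≤ t) (p : Fin n) :
    IsTSpreadStronglyStable t (edgeIdeal K (borelEdge t p)) := by
  refine ⟨⟨edgeExps (borelEdge t p), ?_, rfl⟩, fun u hu _ j hj i hij hnew => ?_⟩
  · rintro _ ⟨a, b, hab, rfl⟩
    exact isTSpread_pair_of_le hab.2
  · obtain ⟨m, hm, hmu⟩ := monomial_mem_span_iff.1 hu.1
    have hum : u = m :=
      le_antisymm (hu.2 (monomial_mem_span_iff.2 ⟨m, hm, le_rfl⟩) hmu) hmu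
    subst hum
    obtain ⟨a, b, ⟨hap, hab⟩, rfl⟩ := hm
    have hj' : j = a ∨ j = b := by
      by_contra hn
      push Not at hn
      rw [Finsupp.mem_support_iff] at hj
      simp [hn.1.symm, hn.2.symm] at hj
    refine monomial_mem_span_iff.2 ⟨_, ?_, le_rfl⟩
    rcases hj' with rfl | rfl
    · rw [add_tsub_cancel_left, add_comm]
      refine ⟨i, b, ⟨hij.le.trans hap, ?_⟩, rfl⟩
      have : (i : ℕ) < j := hij
      omega
    · rw [add_tsub_cancel_right] at hnew ⊢
      -- The new index `i` may fall below `a`; it then becomes the left end, and `i ≤ a ≤ p`.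
      rcases hnew.pair_le ht with h | h
      · exact ⟨a, i, ⟨hap, h⟩, rfl⟩
      · refine ⟨i, a, ⟨le_trans ?_ hap, h⟩, add_comm _ _⟩
        rw [Fin.le_def]
        omega

/-- `B_t(x_i x_n)` is the edge ideal of the graph with edges `a ≤ i`, `a + t ≤ b`. -/
theorem borel_eq_edgeIdeal {t : ℕ} (ht : 1 ≤ t) {p last : Fin n} (hlast : ∀ v, v ≤ last)
    (hpl : (p : ℕ) + t ≤ last) :
    borel K t (Finsupp.single p 1 + Finsupp.single last 1) = edgeIdeal K (borelEdge t p) := by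
  refine le_antisymm (sInf_le ⟨isTSpreadStronglyStable_edgeIdeal ht p, ?_⟩) (le_sInf ?_)
  · exact monomial_mem_span_iff.2 ⟨_, ⟨p, last, ⟨le_rfl, hpl⟩, rfl⟩, le_rfl⟩
  · rintro J ⟨hJ, huJ⟩
    rw [edgeIdeal_le_iff]
    rintro a b ⟨hap, hab⟩
    have hap' : (a : ℕ) ≤ p := hap
    have hbl : (b : ℕ) ≤ last := hlast b
    -- Lowering `p` to `a` before `last` to `b` keeps the intermediate monomial `t`-spread; `p, b`
    -- need not be.
    have h1 : monomial (Finsupp.single a 1 + Finsupp.single last 1) (1 : K) ∈ J := by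
      rcases hap.eq_or_lt with rfl | hlt
      · exact huJ
      · have := hJ.exchange ht (isTSpread_pair_of_le hpl) huJ hlt
        rw [add_tsub_cancel_left, add_comm] at this
        exact this (isTSpread_pair_of_le (by omega))
    rw [← monomial_edge]
    rcases (hlast b).eq_or_lt with rfl | hlt
    · exact h1
    · have := hJ.exchange ht (isTSpread_pair_of_le (by omega)) h1 hlt
      rw [add_tsub_cancel_right] at this
      exact this (isTSpread_pair_of_le hab)

/-! ### The ideal of all variables, and the covers behind the other associated primes. -/

theorem span_range_X_eq_image :
    Ideal.span (Set.range (X : Fin n → MvPolynomial (Fin n) K)) =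
      Ideal.span (X '' ((Finset.univ : Finset (Fin n)) : Set (Fin n))) := by
  rw [Finset.coe_univ, Set.image_univ]

/-- Modulo the variables only constants remain, and nonzero ones are units. Primality is not
assumed, so this applies to a colon ideal. -/
theorem eq_span_range_X {P : Ideal (MvPolynomial (Fin n) K)} (hP : P ≠ ⊤) (hX : ∀ v, X v ∈ P) :
    P = Ideal.span (Set.range (X : Fin n → MvPolynomial (Fin n) K)) := by
  have hle : Ideal.span (Set.range (X : Fin n → MvPolynomial (Fin n) K)) ≤ P := by
    rw [Ideal.span_le]
    rintro _ ⟨v, rfl⟩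
    exact hX v
  refine le_antisymm (fun g hg => ?_) hle
  have hsub : g - C (coeff 0 g) ∈ Ideal.span (Set.range (X : Fin n → MvPolynomial (Fin n) K)) := by
    rw [← Set.image_univ, mem_ideal_span_X_image]
    intro c hc
    by_contra hn
    push Not at hn
    have hc0 : c = 0 := by
      ext v
      exact hn v (Set.mem_univ v)
    subst hc0
    simp at hc
  by_cases h0 : coeff 0 g = 0
  · simpa [h0] using hsub
  · refine absurd (Ideal.eq_top_of_isUnit_mem P ?_ ((isUnit_iff_ne_zero.2 h0).map C)) hP
    simpa using P.sub_mem hg (hle hsub)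

/-- The graph has a triangle through which every vertex can be matched, so the maximal ideal is
associated to all powers from the second one on. -/
theorem span_range_X_mem_Ass_pow {t : ℕ} {p last : Fin n}
    (hpl : (p : ℕ) + t ≤ last) (htp : t ≤ p) (k : ℕ) :
    Ideal.span (Set.range (X : Fin n → MvPolynomial (Fin n) K)) ∈
      Ass (edgeIdeal K (borelEdge t p) ^ (k + 2)) := by
  have hln := last.isLt
  let a : Fin n := ⟨0, by omega⟩
  let b : Fin n := ⟨t, by omega⟩
  let d : Fin n := ⟨2 * t, by omega⟩
  have hE : ∀ x y : Fin n, (x : ℕ) ≤ p → (x : ℕ) + t ≤ y →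
      (X x * X y : MvPolynomial (Fin n) K) ∈ edgeIdeal K (borelEdge t p) :=
    fun x y hx hy => edgeIdeal_le_iff.1 le_rfl x y ⟨hx, hy⟩
  let w : Fin n →₀ ℕ := (Finsupp.single a 1 + Finsupp.single b 1) + Finsupp.single d 1 +
    k • (Finsupp.single a 1 + Finsupp.single b 1)
  have hw : monomial w (1 : K) = (X a * X b) * X d * (X a * X b) ^ k := by
    rw [← monomial_edge, X, monomial_mul, monomial_pow, monomial_mul]
    simp [w]
  -- By degree: `w` has degree `2k + 3`, below `2(k + 2)`.
  have hnot : monomial w (1 : K) ∉ edgeIdeal K (borelEdge t p) ^ (k + 2) := by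
    rw [edgeIdeal, span_monomial_pow, monomial_mem_span_iff]
    rintro ⟨m, hm, hmw⟩
    have hA : ∀ e ∈ edgeExps (borelEdge t p), 2 ≤ weight Finset.univ e := by
      rintro _ ⟨x, y, _, rfl⟩
      simp [weight_add, weight_single]
    have h1 := weight_le_of_mem_sumset hA hm
    have h2 := weight_mono_right Finset.univ hmw
    have h3 : ∀ j : ℕ, weight Finset.univ
        (j • (Finsupp.single a 1 + Finsupp.single b 1 : Fin n →₀ ℕ)) = j * 2 := by
      intro j
      induction j with
      | zero => simp [weight]
      | succ j ih => rw [succ_nsmul, weight_add, ih]; simp [weight_add, weight_single]; ring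
    simp only [w, weight_add, weight_single, h3, Finset.mem_univ, if_true] at h2
    omega
  have hX : ∀ v, X v * monomial w (1 : K) ∈ edgeIdeal K (borelEdge t p) ^ (k + 2) := by
    intro v
    have h2 : X v * ((X a * X b) * X d) ∈ edgeIdeal K (borelEdge t p) ^ 2 := by
      rw [pow_two]
      -- Either `v` pairs with `0`, leaving the edge `t, 2t`, or `v < t` pairs with `2t`, leaving
      -- `0, t`.
      by_cases hv : t ≤ v
      · have := Ideal.mul_mem_mul (hE a v (Nat.zero_le _) (by simpa [a] using hv))
          (hE b d htp (by simp only [b, d]; omega))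
        convert this using 1
        ring
      · have := Ideal.mul_mem_mul (hE v d (by omega) (by simp only [d]; omega))
          (hE a b (Nat.zero_le _) (by simp [a, b]))
        convert this using 1
        ring
    rw [hw, ← mul_assoc, add_comm k 2, pow_add]
    exact Ideal.mul_mem_mul h2 (Ideal.pow_mem_pow (hE a b (Nat.zero_le _) (by simp [a, b])) k)
  have hcolon := eq_span_range_X (K := K)
    (P := (edgeIdeal K (borelEdge t p) ^ (k + 2)).colon {monomial w (1 : K)})
    (by
      rw [Ideal.ne_top_iff_one, Submodule.mem_colon_singleton, one_smul]
      exact hnot)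
    (fun v => Submodule.mem_colon_singleton.2 (hX v))
  refine mem_Ass_iff.2 ⟨?_, monomial w 1, fun g => ?_⟩
  · rw [span_range_X_eq_image]
    exact isPrime_span_X_image _
  · rw [← hcolon, Submodule.mem_colon_singleton, smul_eq_mul]

theorem span_range_X_notMem_minimalPrimes {t : ℕ} (ht : 1 ≤ t) {p last : Fin n}
    (hpl : (p : ℕ) + t ≤ last) :
    Ideal.span (Set.range (X : Fin n → MvPolynomial (Fin n) K)) ∉
      (edgeIdeal K (borelEdge t p)).minimalPrimes := by
  intro h
  -- Since `last > p`, it is never a left end, so all other vertices form a cover.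
  have hcov : IsCover (borelEdge t p) (Finset.univ.erase last) := by
    rintro a b ⟨hap, hab⟩
    left
    refine Finset.mem_erase.2 ⟨fun h => ?_, Finset.mem_univ _⟩
    subst h
    rw [Fin.le_def] at hap
    omega
  have hle := h.2 ⟨isPrime_span_X_image _, edgeIdeal_le_span_X_image (K := K) hcov⟩
    (Ideal.span_mono (Set.image_subset_range _ _))
  have := X_mem_span_X_image.1 (hle (Ideal.subset_span ⟨last, rfl⟩))
  simp at this

theorem exists_minimal_cover_of_mem_Ass_pow {t : ℕ} (ht : 1 ≤ t) {p : Fin n} {k : ℕ}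
    {P : Ideal (MvPolynomial (Fin n) K)} (hP : P ∈ Ass (edgeIdeal K (borelEdge t p) ^ k))
    (h : (p : ℕ) < t ∨ k = 1 ∨
      P ≠ Ideal.span (Set.range (X : Fin n → MvPolynomial (Fin n) K))) :
    ∃ C : Finset (Fin n), Minimal (IsCover (borelEdge t p)) C ∧
      P = Ideal.span ((X : Fin n → MvPolynomial (Fin n) K) '' C) := by
  refine exists_cover_of_mem_Ass hP fun c hc hm => ?_
  have key : ((p : ℕ) < t ∨ ∃ j, k ≤ c j) → ∃ C, IsCover (borelEdge t p) C ∧ weight C c < k := by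
    intro hj
    by_contra hn
    push Not at hn
    exact hm (exists_sumset_le ht k c hj hn)
  rcases h with h | rfl | h
  · exact key (Or.inl h)
  · refine exists_cover_weight_lt_one (fun a b hab e => ?_) c hm
    subst e
    have := hab.2
    omega
  · have : ∃ j, (X j : MvPolynomial (Fin n) K) ∉ P := by
      by_contra hn
      push Not at hn
      exact h (eq_span_range_X (mem_Ass_iff.1 hP).1.ne_top hn)
    obtain ⟨j, hj⟩ := this
    exact key (Or.inr ⟨j, hc j hj⟩)

end Borel

end TSpread

/-- Indices in `Fin n` start at `0`: the variable `x_i` is `X` at the element of `Fin n` with value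
`i - 1`. So `p` stands for `i = p + 1`, and `last` stands for `n = last + 1`. -/
theorem proposition3p4 {K : Type*} [Field K] (n t : ℕ) (ht : 1 ≤ t)
    (p last : Fin n) (hlast : (last : ℕ) + 1 = n)
    (hu : TSpread.IsTSpread t (Finsupp.single p 1 + Finsupp.single last 1))
    (hp : t ≤ (p : ℕ) + 1) :
    TSpread.IsAlmostNormallyTorsionfree
        (TSpread.borel K t (Finsupp.single p 1 + Finsupp.single last 1)) ∧
      (TSpread.IsNormallyTorsionfree
          (TSpread.borel K t (Finsupp.single p 1 + Finsupp.single last 1)) ↔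
        (p : ℕ) + 1 = t) ∧
      (t < (p : ℕ) + 1 →
        TSpread.AssInfty (TSpread.borel K t (Finsupp.single p 1 + Finsupp.single last 1)) =
          (TSpread.borel K t (Finsupp.single p 1 + Finsupp.single last 1)).minimalPrimes ∪
            {Ideal.span (Set.range (MvPolynomial.X : Fin n → MvPolynomial (Fin n) K))}) := by
  have hall : ∀ v : Fin n, v ≤ last := fun v => by
    rw [Fin.le_def]
    omega
  have hpl : (p : ℕ) + t ≤ last := by
    rcases hu.pair_le ht with h | h
    · exact h
    · have : (p : ℕ) ≤ last := hall p
      omega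
  rw [TSpread.borel_eq_edgeIdeal ht hall hpl]
  set I := TSpread.edgeIdeal K (TSpread.borelEdge t p) with hI
  set M := Ideal.span (Set.range (MvPolynomial.X : Fin n → MvPolynomial (Fin n) K)) with hM
  have hMprime : TSpread.IsMonomialPrime M := by
    rw [hM, TSpread.span_range_X_eq_image]
    exact ⟨TSpread.isPrime_span_X_image _, TSpread.isMonomialIdeal_span_X_image _⟩
  have hAss : ∀ k P, P ∈ TSpread.Ass (I ^ k) → ((p : ℕ) < t ∨ k = 1 ∨ P ≠ M) →
      P ∈ I.minimalPrimes := by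
    intro k P hP h
    obtain ⟨C, hC, rfl⟩ := TSpread.exists_minimal_cover_of_mem_Ass_pow ht hP h
    exact TSpread.span_X_image_mem_minimalPrimes hC
  have hMass : t ≤ p → ∀ k, M ∈ TSpread.Ass (I ^ (k + 2)) :=
    fun h => TSpread.span_range_X_mem_Ass_pow hpl h
  have hMin : ∀ k, 1 ≤ k → I.minimalPrimes ⊆ TSpread.Ass (I ^ k) :=
    fun k => TSpread.minimalPrimes_subset_Ass_pow I
  refine ⟨⟨1, le_rfl, M, hMprime, fun m hm1 hm2 => ?_, fun m _ P hP => ?_⟩,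
    ⟨fun h => ?_, fun h k hk => ?_⟩, fun htp => ?_⟩
  · obtain rfl : m = 1 := le_antisymm hm2 hm1
    exact Set.Subset.antisymm (fun P hP => hAss 1 P hP (Or.inr (Or.inl rfl))) (hMin 1 le_rfl)
  · by_cases hPM : P = M
    · exact Or.inr hPM
    · exact Or.inl (hAss m P hP (Or.inr (Or.inr hPM)))
  -- The second power already has the ideal of all variables as an embedded prime.
  · by_contra hne
    refine TSpread.span_range_X_notMem_minimalPrimes (K := K) ht hpl ?_
    rw [← hI, ← h 2 one_le_two]
    exact hMass (by omega) 0
  · exact Set.Subset.antisymm (fun P hP => hAss k P hP (Or.inl (by omega))) (hMin k hk)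
  · refine Set.Subset.antisymm ?_ (Set.union_subset ?_ ?_)
    · rintro P ⟨_, _, ⟨k, _, hP⟩, _⟩
      by_cases hPM : P = M
      · exact Or.inr hPM
      · exact Or.inl (hAss k P hP (Or.inr (Or.inr hPM)))
    · intro P hP
      refine ⟨⟨hP.1.1, ?_⟩, hP.1.2, ⟨1, le_rfl, hMin 1 le_rfl hP⟩,
        fun k _ _ => hMin (k + 1) (by omega) hP⟩
      obtain ⟨C, _, rfl⟩ := TSpread.exists_minimal_cover_of_mem_Ass_pow ht
        (hMin 1 le_rfl hP) (Or.inr (Or.inl rfl))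
      exact TSpread.isMonomialIdeal_span_X_image _
    · rintro _ rfl
      refine ⟨hMprime, ?_, ⟨2, one_le_two, hMass (by omega) 0⟩, fun k hk _ => ?_⟩
      · rw [hM, TSpread.span_range_X_eq_image]
        exact TSpread.edgeIdeal_le_span_X_image fun a _ _ => Or.inl (Finset.mem_univ a)
      · obtain ⟨j, rfl⟩ := Nat.exists_eq_add_of_le hk
        rw [add_comm 1 j]
        exact hMass (by omega) j
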